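/- A dynamical structure is a set $X$ (of pure states) with an action of a group $G$; for $x\in X$ write $H_x=\{g\in G: gx=x\}$. A probabilistic structure on $(X,G)$ is a nonempty set $\mathcal F$ of functions $f:X\to[0,1]$ that is closed under mixtures $\lambda f_1+(1-\lambda)f_2$ with $\lambda\in[0,1]$, under $f\mapsto f\circ g$ for $g\in G$, under complements $f\mapsto 1-f$, and under coarse graining: if $f_1,\dots,f_n\in\mathcal F$ and $\sum_i f_i=1$, then $f_i+f_j\in\mathcal F$ for $i\ne j$. It separates pure states if for all $x_1\neq x_2$ in $X$ some $f\in\mathcal F$ has $f(x_1)\ne f(x_2)$. Put $\mathbb R[\mathcal F]=\mathrm{span}_{\mathbb R}\mathcal F$. $G$ acts two-point homogeneously on $(X,d)$ if for all $x_1,x_2,x_1',x_2'\in X$ with $d(x_1,x_2)=d(x_1',x_2')$ there is $g\in G$ with $gx_1=x_1'$ and $gx_2=x_2'$. For a topological group $G$ and a subgroup $H$, $(G,H)$ is a Gelfand pair if in every irreducible continuous finite-dimensional complex representation of $G$ the space of $H$-invariant vectors has dimension at most $1$. When $X$ is a topological space, call a probabilistic structure $\mathcal F$ unrestricted if its elements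 are continuous, $\dim\mathbb R[\mathcal F]<\infty$, and $\mathcal F$ contains every $f\in\mathbb R[\mathcal F]$ with values in $[0,1]$. For probabilistic structures $\mathcal F^0,\mathcal F^1$ put $D(\mathcal F^0,\mathcal F^1)=\sup_{f^0\in\mathcal F^0}\inf_{f^1\in\mathcal F^1}\sup_{x\in X}|f^0(x)-f^1(x)|$ and $D_{\mathrm{sym}}(\mathcal F^0,\mathcal F^1)=\max\{D(\mathcal F^0,\mathcal F^1),D(\mathcal F^1,\mathcal F^0)\}$. An unrestricted $\mathcal F^0$ is rigid if there is $\varepsilon>0$ such that $D_{\mathrm{sym}}(\mathcal F^0,\mathcal F^1)\ge\varepsilon$ for every unrestricted $\mathcal F^1\ne\mathcal F^0$ with $\dim\mathbb R[\mathcal F^1]=\dim\mathbb R[\mathcal F^0]$. **Theorem.** (1) Let $\mathcal F$ be a probabilistic structure on $(X,G)$ that separates pure states. Then $$\mathrm{dist}_{\mathcal F}(x,x')=\sup_{f\in\mathcal F}\,[f(x)-f(x')]$$ is a metric on $X$ with $\mathrm{dist}_{\mathcal F}\le 1$ and $\mathrm{dist}_{\mathcal F}(gx,gx')=\mathrm{dist}_{\mathcal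 F}(x,x')$ for all $g\in G$ and $x,x'\in X$. (2) Suppose in addition that $G$ is a compact topological group, $X$ is a compact Hausdorff space and the action $G\times X\to X$ is continuous. If $G$ acts two-point homogeneously on $(X,\mathrm{dist}_{\mathcal F})$ for some $\mathcal F$ as in (1), or more generally on $(X,d)$ for some metric $d$ on the set $X$, then $(G,H_x)$ is a Gelfand pair for every $x\in X$, and every unrestricted probabilistic structure on $(X,G)$ is rigid. -/

import Mathlib

/-- A set `F` of real functions on the set `X` of pure states is a *probabilistic structure* for
the dynamical structure `(X, G)` when its elements are outcome probability functions
`X → [0,1]`, and it is nonempty, closed under mixtures, under composition with the group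
transformations, under coarse graining of two distinct outcomes of a measurement (a measurement is
a finite list of elements of `F` which adds up to the unit function), and under complements. -/
structure IsProbabilisticStructure {X : Type*} (G : Type*) [Group G] [MulAction G X]
    (F : Set (X → ℝ)) : Prop where
  nonempty : F.Nonempty
  mem_unitInterval : ∀ f ∈ F, ∀ x, f x ∈ Set.Icc (0 : ℝ) 1
  mixture : ∀ f₁ ∈ F, ∀ f₂ ∈ F, ∀ l ∈ Set.Icc (0 : ℝ) 1, l • f₁ + (1 - l) • f₂ ∈ F
  comp_smul : ∀ f ∈ F, ∀ g : G, (fun x => f (g • x)) ∈ F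
  coarseGraining : ∀ (n : ℕ) (m : Fin n → X → ℝ), (∀ i, m i ∈ F) →
    (∀ x, ∑ i, m i x = 1) → ∀ i j, i ≠ j → m i + m j ∈ F
  complement : ∀ f ∈ F, (fun x => 1 - f x) ∈ F

/-- `F` separates the pure states. -/
def SeparatesPureStates {X : Type*} (F : Set (X → ℝ)) : Prop :=
  ∀ x₁ x₂ : X, x₁ ≠ x₂ → ∃ f ∈ F, f x₁ ≠ f x₂

/-- The pure-state distance `sup_{f ∈ F} [f x - f x']`. -/
noncomputable def pureStateDist {X : Type*} (F : Set (X → ℝ)) (x x' : X) : ℝ :=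
  sSup {r : ℝ | ∃ f ∈ F, r = f x - f x'}

/-- The metric axioms for a real-valued function of two points (nonnegativity follows). -/
structure IsMetric {X : Type*} (d : X → X → ℝ) : Prop where
  eq_zero_iff : ∀ x x', d x x' = 0 ↔ x = x'
  symm : ∀ x x', d x x' = d x' x
  triangle : ∀ x x' x'', d x x'' ≤ d x x' + d x' x''

/-- `G` acts two-point homogeneously on `X` with respect to the distance `d`. -/
def IsTwoPointHomogeneous {X : Type*} (G : Type*) [Group G] [MulAction G X]
    (d : X → X → ℝ) : Prop :=
  ∀ x₁ x₂ x₁' x₂' : X, d x₁ x₂ = d x₁' x₂' → ∃ g : G, g • x₁ = x₁' ∧ g • x₂ = x₂'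

/-- A representation of a topological group on a finite-dimensional complex space is continuous
when all its matrix coefficients are. -/
def HasContinuousCoefficients {G : Type*} [Group G] [TopologicalSpace G] {V : Type*}
    [AddCommGroup V] [Module ℂ V] (ρ : Representation ℂ G V) : Prop :=
  ∀ (v : V) (φ : Module.Dual ℂ V), Continuous fun g => φ (ρ g v)

universe u v w

/-- `(G, H)` is a Gelfand pair: in every (continuous, finite-dimensional) complex irreducible
representation of `G` the `H`-invariant vectors span a space of dimension at most one. -/
def IsGelfandPair (G : Type*) [Group G] [TopologicalSpace G] (H : Subgroup G) : Prop :=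
  ∀ (V : Type v) [AddCommGroup V] [Module ℂ V] [FiniteDimensional ℂ V]
    (ρ : Representation ℂ G V), HasContinuousCoefficients ρ → ρ.IsIrreducible →
    Module.finrank ℂ (Representation.invariants (ρ.comp H.subtype)) ≤ 1

/-- The linear space `ℝ[F]` spanned by the outcome probability functions. -/
def opfSpan {X : Type*} (F : Set (X → ℝ)) : Submodule ℝ (X → ℝ) :=
  Submodule.span ℝ F

/-- An *unrestricted* probabilistic structure, on a dynamical structure with topology, with the
standing assumptions of continuity and of finite dimension of `ℝ[F]`. Unrestricted means
that `F` contains every element of `ℝ[F]` (that is, every linear functional on the dual of `ℝ[F]`,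
where the states live) which takes values in `[0,1]` on the pure states. -/
structure IsUnrestrictedStructure {X : Type*} (G : Type*) [Group G] [MulAction G X]
    [TopologicalSpace X] (F : Set (X → ℝ)) : Prop extends IsProbabilisticStructure G F where
  continuous : ∀ f ∈ F, Continuous f
  finiteDimensional : FiniteDimensional ℝ (opfSpan F)
  unrestricted : ∀ f ∈ opfSpan F, (∀ x, f x ∈ Set.Icc (0 : ℝ) 1) → f ∈ F

/-- The distance `max_x |f⁰ x - f¹ x|` of two outcome probability functions. -/
noncomputable def opfDist {X : Type*} (f₀ f₁ : X → ℝ) : ℝ :=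
  ⨆ x, |f₀ x - f₁ x|

/-- The one-sided distance `max_{f⁰ ∈ F⁰} min_{f¹ ∈ F¹} dist(f⁰, f¹)`. -/
noncomputable def structureDist {X : Type*} (F₀ F₁ : Set (X → ℝ)) : ℝ :=
  ⨆ f₀ : F₀, ⨅ f₁ : F₁, opfDist (f₀ : X → ℝ) (f₁ : X → ℝ)

/-- The symmetrised distance of two probabilistic structures. -/
noncomputable def structureDistSym {X : Type*} (F₀ F₁ : Set (X → ℝ)) : ℝ :=
  max (structureDist F₀ F₁) (structureDist F₁ F₀)

/-- `F₀` is *rigid*: the symmetrised distance from `F₀` to the other unrestricted probabilistic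
structures of the same linear dimension is bounded below by a positive constant. -/
def IsRigid {X : Type*} (G : Type*) [Group G] [MulAction G X] [TopologicalSpace X]
    (F₀ : Set (X → ℝ)) : Prop :=
  ∃ ε : ℝ, 0 < ε ∧ ∀ F₁ : Set (X → ℝ), IsUnrestrictedStructure G F₁ →
    Module.finrank ℝ (opfSpan F₁) = Module.finrank ℝ (opfSpan F₀) → F₁ ≠ F₀ →
    ε ≤ structureDistSym F₀ F₁

/-! Complements make the pure-state distance symmetric. For a symmetric distance, two-point
homogeneity lets some group element swap any two given points, and the compact case uses nothing
else. Gelfand pair: if `k` swaps `x` and `g • x`, then `g⁻¹ * k` and `k * g` fix `x`, so `g⁻¹` lies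
in the double coset of `g`. Gelfand's trick then makes the compressions of all `ρ g` to the
invariant vectors commute (`isGelfandPair_of_inv_mem_doubleCoset`). Rigidity: Haar measure gives an
invariant inner product on `C(X, ℝ)`, and invariant finite-dimensional subspaces have invariant
reproducing kernels. Swapping points forces the orthogonal projections of two such subspaces to
commute, so distinct ones of equal dimension leave a nonzero `f` in the first orthogonal to the
second (`exists_ne_zero_orthogonal`). Rescaled into `[0,1]`, `f` stays uniformly far from the second
structure. -/

/-! ### The pure-state metric. -/

theorem isLUB_pureStateDist {G X : Type*} [Group G] [MulAction G X] {F : Set (X → ℝ)}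
    (hF : IsProbabilisticStructure G F) (x x' : X) :
    IsLUB {r : ℝ | ∃ f ∈ F, r = f x - f x'} (pureStateDist F x x') := by
  obtain ⟨f, hf⟩ := hF.nonempty
  refine isLUB_csSup ⟨_, f, hf, rfl⟩ ⟨1, ?_⟩
  rintro _ ⟨f, hf, rfl⟩
  linarith [(hF.mem_unitInterval f hf x).2, (hF.mem_unitInterval f hf x').1]

theorem pureStateDist_le_one {G X : Type*} [Group G] [MulAction G X] {F : Set (X → ℝ)}
    (hF : IsProbabilisticStructure G F) (x x' : X) : pureStateDist F x x' ≤ 1 := by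
  refine (isLUB_pureStateDist hF x x').2 ?_
  rintro _ ⟨f, hf, rfl⟩
  linarith [(hF.mem_unitInterval f hf x).2, (hF.mem_unitInterval f hf x').1]

theorem sub_le_pureStateDist {G X : Type*} [Group G] [MulAction G X] {F : Set (X → ℝ)}
    (hF : IsProbabilisticStructure G F) {f : X → ℝ} (hf : f ∈ F) (x x' : X) :
    f x - f x' ≤ pureStateDist F x x' :=
  (isLUB_pureStateDist hF x x').1 ⟨f, hf, rfl⟩

/-- Replacing `f` by `1 - f` reverses the sign of `f x - f x'`. -/
theorem pureStateDist_comm {G X : Type*} [Group G] [MulAction G X] {F : Set (X → ℝ)}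
    (hF : IsProbabilisticStructure G F) (x x' : X) :
    pureStateDist F x x' = pureStateDist F x' x := by
  have key : ∀ x x', pureStateDist F x x' ≤ pureStateDist F x' x := by
    intro x x'
    refine (isLUB_pureStateDist hF x x').2 ?_
    rintro _ ⟨f, hf, rfl⟩
    have := sub_le_pureStateDist hF (hF.complement f hf) x' x
    linarith
  exact le_antisymm (key _ _) (key _ _)

theorem isMetric_pureStateDist {G X : Type*} [Group G] [MulAction G X] {F : Set (X → ℝ)}
    (hF : IsProbabilisticStructure G F) (hs : SeparatesPureStates F) :
    IsMetric (pureStateDist F) where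
  eq_zero_iff x x' := by
    constructor
    · intro h
      by_contra hne
      obtain ⟨f, hf, hfx⟩ := hs x x' hne
      have h₁ := sub_le_pureStateDist hF hf x x'
      have h₂ := sub_le_pureStateDist hF hf x' x
      rw [pureStateDist_comm hF, h] at h₂
      exact hfx (by linarith)
    · rintro rfl
      refine (isLUB_pureStateDist hF x x).unique ?_
      obtain ⟨f, hf⟩ := hF.nonempty
      refine ⟨?_, fun b hb => hb ⟨f, hf, (sub_self _).symm⟩⟩
      rintro _ ⟨f, hf, rfl⟩
      simp
  symm := pureStateDist_comm hF
  triangle x x' x'' := by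
    refine (isLUB_pureStateDist hF x x'').2 ?_
    rintro _ ⟨f, hf, rfl⟩
    linarith [sub_le_pureStateDist hF hf x x', sub_le_pureStateDist hF hf x' x'']

theorem pureStateDist_smul_smul {G X : Type*} [Group G] [MulAction G X] {F : Set (X → ℝ)}
    (hF : IsProbabilisticStructure G F) (g : G) (x x' : X) :
    pureStateDist F (g • x) (g • x') = pureStateDist F x x' := by
  refine le_antisymm ((isLUB_pureStateDist hF _ _).2 ?_) ((isLUB_pureStateDist hF _ _).2 ?_)
  · rintro _ ⟨f, hf, rfl⟩
    exact sub_le_pureStateDist hF (hF.comp_smul f hf g) x x'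
  · rintro _ ⟨f, hf, rfl⟩
    have := sub_le_pureStateDist hF (hF.comp_smul f hf g⁻¹) (g • x) (g • x')
    simpa using this

theorem IsTwoPointHomogeneous.exists_smul_swap {G X : Type*} [Group G] [MulAction G X]
    {d : X → X → ℝ} (hd : IsMetric d) (h : IsTwoPointHomogeneous G d) (x y : X) :
    ∃ g : G, g • x = y ∧ g • y = x :=
  h x y y x (hd.symm x y)

/-! ### Haar averaging and Gelfand's lemma. -/

section Averaging

open MeasureTheory

variable {K : Type*} [TopologicalSpace K] [CompactSpace K] [MeasurableSpace K] [BorelSpace K]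
  {V : Type*} [AddCommGroup V] [Module ℂ V] [FiniteDimensional ℂ V]

theorem Continuous.integrable_of_compactSpace {E : Type*} [NormedAddCommGroup E]
    [SecondCountableTopologyEither K E] (μ : Measure K) [IsFiniteMeasure μ] {f : K → E}
    (hf : Continuous f) : Integrable f μ :=
  hf.integrable_of_hasCompactSupport (HasCompactSupport.of_compactSpace f)

/-- The weak integral of a weakly continuous function with values in a finite-dimensional
space. -/
theorem exists_weak_integral (μ : Measure K) [IsFiniteMeasure μ] (F : K → V)
    (hF : ∀ φ : Module.Dual ℂ V, Continuous fun k => φ (F k)) :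
    ∃ w : V, ∀ φ : Module.Dual ℂ V, φ w = ∫ k, φ (F k) ∂μ := by
  let I : Module.Dual ℂ (Module.Dual ℂ V) :=
    { toFun := fun φ => ∫ k, φ (F k) ∂μ
      map_add' := fun φ ψ => by
        simpa using integral_add ((hF φ).integrable_of_compactSpace μ)
          ((hF ψ).integrable_of_compactSpace μ)
      map_smul' := fun c φ => by
        simpa using integral_const_mul c fun k => φ (F k) }
  refine ⟨(Module.evalEquiv ℂ V).symm I, fun φ => ?_⟩
  rw [← Module.Dual.eval_apply ℂ V, ← Module.evalEquiv_toLinearMap]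
  simp [I]

theorem HasContinuousCoefficients.continuous_dual_end {K : Type*} [Group K] [TopologicalSpace K]
    {ρ : Representation ℂ K V} (hρ : HasContinuousCoefficients ρ)
    (Φ : Module.Dual ℂ (Module.End ℂ V)) : Continuous fun k => Φ (ρ k) := by
  let b := Module.finBasis ℂ V
  have h : ∀ A : Module.End ℂ V,
      Φ A = ∑ p, b.coord p.1 (A (b p.2)) * Φ (b.linearMap b p) := by
    intro A
    conv_lhs => rw [← (b.linearMap b).sum_repr A]
    rw [map_sum]
    refine Finset.sum_congr rfl fun p _ => ?_
    rw [map_smul, smul_eq_mul]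
    congr 1
    simp [Module.Basis.linearMap, Matrix.stdBasis, LinearMap.toMatrix_apply]
  rw [funext fun k => h (ρ k)]
  exact continuous_finsetSum _ fun p _ => (hρ _ _).mul continuous_const

/-- The averaging projection of a continuous representation of a compact group. -/
theorem exists_averaging_projection [Group K] [IsTopologicalGroup K]
    (μ : Measure K) [IsProbabilityMeasure μ] [μ.IsMulLeftInvariant]
    {ρ : Representation ℂ K V} (hρ : HasContinuousCoefficients ρ) :
    ∃ P : Module.End ℂ V, (∀ k, ρ k * P = P) ∧ (∀ k, P * ρ k = P) ∧
      (∀ v ∈ ρ.invariants, P v = v) ∧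
      (∀ Φ : Module.Dual ℂ (Module.End ℂ V), Φ P = ∫ k, Φ (ρ k) ∂μ) ∧
      ∀ Φ : Module.Dual ℂ (Module.End ℂ V), Φ P = ∫ k, Φ (ρ k⁻¹) ∂μ := by
  -- `P` averages `ρ k` and absorbs on the left; `Q` averages `ρ k⁻¹` and absorbs on the right.
  -- Evaluating `Q * P` both ways gives `P = Q`, so left invariance of `μ` suffices.
  obtain ⟨P, hP⟩ := exists_weak_integral μ (fun k => ρ k) fun Φ => hρ.continuous_dual_end Φ
  obtain ⟨Q, hQ⟩ := exists_weak_integral μ (fun k => ρ k⁻¹)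
    fun Φ => (hρ.continuous_dual_end Φ).comp continuous_inv
  have ext : ∀ A B : Module.End ℂ V, (∀ Φ : Module.Dual ℂ (Module.End ℂ V), Φ A = Φ B) → A = B :=
    fun A B h => (Module.forall_dual_apply_eq_zero_iff ℂ (A - B)).1
      (fun Φ => by rw [map_sub, h, sub_self]) |> sub_eq_zero.1
  have hleft : ∀ k, ρ k * P = P := fun k => ext _ _ fun Φ => by
    have := hP (Φ ∘ₗ LinearMap.mulLeft ℂ (ρ k))
    simp only [LinearMap.comp_apply, LinearMap.mulLeft_apply, ← map_mul] at this
    rw [this, hP, integral_mul_left_eq_self fun x => Φ (ρ x)]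
  have hright : ∀ k, Q * ρ k = Q := fun k => ext _ _ fun Φ => by
    have := hQ (Φ ∘ₗ LinearMap.mulRight ℂ (ρ k))
    simp only [LinearMap.comp_apply, LinearMap.mulRight_apply, ← map_mul] at this
    rw [this, hQ, ← integral_mul_left_eq_self (fun x => Φ (ρ x⁻¹)) k⁻¹]
    simp
  have hQP : Q * P = P := ext _ _ fun Φ => by
    have := hQ (Φ ∘ₗ LinearMap.mulRight ℂ P)
    simp only [LinearMap.comp_apply, LinearMap.mulRight_apply, hleft] at this
    simpa using this
  have hQP' : Q * P = Q := ext _ _ fun Φ => by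
    have := hP (Φ ∘ₗ LinearMap.mulLeft ℂ Q)
    simp only [LinearMap.comp_apply, LinearMap.mulLeft_apply, hright] at this
    simpa using this
  obtain rfl : P = Q := hQP.symm.trans hQP'
  refine ⟨P, hleft, hright, fun v hv => ?_, hP, hQ⟩
  refine sub_eq_zero.1 ((Module.forall_dual_apply_eq_zero_iff ℂ _).1 fun φ => ?_)
  have := hP (φ ∘ₗ LinearMap.applyₗ v)
  simp only [LinearMap.comp_apply, LinearMap.applyₗ_apply_apply, (ρ.mem_invariants v).1 hv] at this
  simp [this]

end Averaging

/-- Gelfand's lemma: if each `g⁻¹` lies in the double coset `H g H` then `(G, H)` is a Gelfand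
pair. -/
theorem isGelfandPair_of_inv_mem_doubleCoset {G : Type u} [Group G] [TopologicalSpace G]
    [IsTopologicalGroup G] (H : Subgroup G) [CompactSpace H]
    (hH : ∀ g : G, ∃ h ∈ H, ∃ k ∈ H, g⁻¹ = h * g * k) : IsGelfandPair.{v} G H := by
  intro V _ _ _ ρ hρ hirr
  let _ : MeasurableSpace H := borel H
  have : BorelSpace H := ⟨rfl⟩
  let μ : MeasureTheory.Measure H := MeasureTheory.Measure.haarMeasure ⊤
  have : MeasureTheory.IsProbabilityMeasure μ :=
    ⟨MeasureTheory.Measure.haarMeasure_self (K₀ := (⊤ : TopologicalSpace.PositiveCompacts H))⟩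
  obtain ⟨P, hl, hr, hinv, hP, hP'⟩ :=
    exists_averaging_projection (K := H) μ (ρ := ρ.comp H.subtype)
      fun v φ => (hρ v φ).comp continuous_subtype_val
  simp only [MonoidHom.comp_apply, Subgroup.subtype_apply, Subtype.forall] at hl hr hP hP'
  let A : G → Module.End ℂ V := fun g => P * ρ g * P
  have hA_inv : ∀ g, A g⁻¹ = A g := by
    intro g
    obtain ⟨h, hh, k, hk, e⟩ := hH g
    simp only [A]
    rw [e, map_mul, map_mul]
    calc P * (ρ h * ρ g * ρ k) * P = (P * ρ h) * ρ g * (ρ k * P) := by simp only [mul_assoc]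
      _ = _ := by rw [hr h hh, hl k hk]
  have hPP : P * P = P := by
    ext v
    exact hinv _ fun k => by simpa using LinearMap.congr_fun (hl k k.2) v
  -- `A g * A g'` is the average of `A (g * k * g')` over `k` in `H`. Inverting the argument, which
  -- does not change `A`, turns it into the average for `A g'⁻¹ * A g⁻¹ = A g' * A g`.
  have hcomm : ∀ g g', A g * A g' = A g' * A g := by
    intro g g'
    have e : ∀ g g', A g * A g' = P * ρ g * P * ρ g' * P := by
      intro g g'
      calc A g * A g' = P * ρ g * (P * P) * ρ g' * P := by simp only [A, mul_assoc]
        _ = _ := by rw [hPP]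
    refine sub_eq_zero.1 ((Module.forall_dual_apply_eq_zero_iff ℂ _).1 fun Φ => ?_)
    rw [map_sub, sub_eq_zero, e, ← hA_inv g, ← hA_inv g', e]
    let L : G → G → Module.End ℂ V →ₗ[ℂ] Module.End ℂ V := fun a b =>
      LinearMap.mulLeft ℂ (P * ρ a) ∘ₗ LinearMap.mulRight ℂ (ρ b * P)
    have hL : ∀ a b T, L a b T = P * ρ a * T * ρ b * P := fun a b T => by
      simp [L, mul_assoc]
    have hLA : ∀ a b c, L a b (ρ c) = A (a * c * b) := fun a b c => by
      simp [hL, A, mul_assoc]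
    have h₁ := hP (Φ ∘ₗ L g g')
    have h₂ := hP' (Φ ∘ₗ L g'⁻¹ g⁻¹)
    simp only [LinearMap.comp_apply, hLA] at h₁ h₂
    rw [← hL, ← hL, h₁, h₂]
    congr 1
    ext k
    rw [← hA_inv (g * k * g')]
    simp [mul_assoc]
  set W := Representation.invariants (ρ.comp H.subtype) with hW
  have hPW : ∀ v, P v ∈ W := fun v k => by simpa using LinearMap.congr_fun (hl k k.2) v
  rcases subsingleton_or_nontrivial W with hsub | hnt
  · simp [Module.finrank_zero_of_subsingleton]
  have hspan : ∀ u : V, u ≠ 0 → Submodule.span ℂ (Set.range fun g => ρ g u) = ⊤ := by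
    intro u hu
    let U : Subrepresentation ρ :=
      { toSubmodule := Submodule.span ℂ (Set.range fun g => ρ g u)
        apply_mem_toSubmodule := fun g v hv => by
          induction hv using Submodule.span_induction with
          | mem x hx =>
            obtain ⟨k, rfl⟩ := hx
            exact Submodule.subset_span ⟨g * k, by simp⟩
          | zero => simp
          | add x y _ _ hx hy => rw [map_add]; exact add_mem hx hy
          | smul c x _ hx => rw [map_smul]; exact Submodule.smul_mem _ c hx }
    have huU : u ∈ U.toSubmodule := Submodule.subset_span ⟨1, by simp⟩
    rcases hirr.eq_bot_or_eq_top U with h | h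
    · rw [h] at huU
      exact absurd ((Submodule.mem_bot ℂ).1 huU) hu
    · exact congrArg Subrepresentation.toSubmodule h
  -- By irreducibility the orbit of `u` spans `V`; apply `P`.
  have hWspan : ∀ u ∈ W, u ≠ 0 → W ≤ Submodule.span ℂ (Set.range fun g => A g u) := by
    intro u hu hu0 w hw
    have : w ∈ (Submodule.span ℂ (Set.range fun g => ρ g u)).map P := by
      rw [hspan u hu0]
      exact ⟨w, trivial, hinv w hw⟩
    rw [Submodule.map_span, ← Set.range_comp] at this
    convert this using 4 with g
    simp [A, hinv u hu]
  -- Schur's argument: an eigenspace of `A g` on `W` is stable under the commuting `A k`, hence is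
  -- all of `W`.
  have hscalar : ∀ g, ∃ c : ℂ, ∀ w ∈ W, A g w = c • w := by
    intro g
    obtain ⟨c, hc⟩ := Module.End.exists_eigenvalue
      ((A g).restrict (p := W) (q := W) fun v _ => by
        simpa [A] using hPW _)
    obtain ⟨u, hu⟩ := hc.exists_hasEigenvector
    have hu1 : A g u = c • (u : V) := congrArg Subtype.val hu.apply_eq_smul
    refine ⟨c, fun w hw => ?_⟩
    have hle : Submodule.span ℂ (Set.range fun k => A k u) ≤ LinearMap.eqLocus (A g) (c • 1) := by
      rw [Submodule.span_le]
      rintro _ ⟨k, rfl⟩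
      change (A g * A k) u = c • A k u
      rw [hcomm, Module.End.mul_apply, hu1, map_smul]
    exact hle (hWspan u u.2 (by simpa using hu.2) hw)
  obtain ⟨u, hu⟩ := exists_ne (0 : W)
  refine finrank_le_one u fun w => ?_
  have hle : Submodule.span ℂ (Set.range fun k => A k u) ≤ Submodule.span ℂ {(u : V)} := by
    rw [Submodule.span_le]
    rintro _ ⟨k, rfl⟩
    obtain ⟨c, hc⟩ := hscalar k
    exact Submodule.mem_span_singleton.2 ⟨c, (hc u u.2).symm⟩
  obtain ⟨c, hc⟩ := Submodule.mem_span_singleton.1 (hle (hWspan u u.2 (by simpa using hu) w.2))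
  exact ⟨c, Subtype.ext hc⟩

/-! ### Reproducing kernels and invariant subspaces. -/

section PositiveForm

variable {E : Type*} [AddCommGroup E] [Module ℝ E] {B : LinearMap.BilinForm ℝ E}

/-- Riesz representation on a finite-dimensional subspace. -/
theorem exists_mem_forall_eq_of_posDef (hpos : ∀ f, f ≠ 0 → 0 < B f f) (V : Submodule ℝ E)
    [FiniteDimensional ℝ V] (φ : E →ₗ[ℝ] ℝ) : ∃ k ∈ V, ∀ f ∈ V, B k f = φ f := by
  let T : V →ₗ[ℝ] Module.Dual ℝ V := (LinearMap.lcomp ℝ ℝ V.subtype) ∘ₗ B ∘ₗ V.subtype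
  have hT : ∀ f h : V, T f h = B f h := fun _ _ => rfl
  have hinj : Function.Injective T := by
    rw [injective_iff_map_eq_zero]
    intro f hf
    by_contra hne
    have := hpos f (by simpa using hne)
    rw [← hT, hf] at this
    simp at this
  have hsurj : Function.Surjective T :=
    (LinearMap.injective_iff_surjective_of_finrank_eq_finrank
      (Subspace.dual_finrank_eq (K := ℝ) (V := V)).symm).1 hinj
  obtain ⟨k, hk⟩ := hsurj (φ ∘ₗ V.subtype)
  exact ⟨k, k.2, fun f hf => LinearMap.congr_fun hk ⟨f, hf⟩⟩

end PositiveForm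

section InvariantSubspaces

variable {G X : Type*} [Group G] [TopologicalSpace X] [MulAction G X] [ContinuousConstSMul G X]

/-- The smulTranslate `f ∘ g` of a continuous function. -/
def smulTranslate (g : G) (f : C(X, ℝ)) : C(X, ℝ) :=
  f.comp ⟨fun x => g • x, continuous_const_smul g⟩

@[simp]
theorem smulTranslate_apply (g : G) (f : C(X, ℝ)) (x : X) : smulTranslate g f x = f (g • x) := rfl

theorem smulTranslate_smulTranslate_inv (g : G) (f : C(X, ℝ)) :
    smulTranslate g (smulTranslate g⁻¹ f) = f := by
  ext x; simp

variable {B : LinearMap.BilinForm ℝ C(X, ℝ)}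

theorem eq_of_forall_mem_eq (hpos : ∀ f, f ≠ 0 → 0 < B f f) {V : Submodule ℝ C(X, ℝ)}
    {k k' : C(X, ℝ)} (hk : k ∈ V) (hk' : k' ∈ V) (h : ∀ f ∈ V, B k f = B k' f) : k = k' := by
  by_contra hne
  have := hpos (k - k') (sub_ne_zero.2 hne)
  rw [LinearMap.BilinForm.sub_left, h _ (sub_mem hk hk'), sub_self] at this
  exact this.false

/-- Both sides represent evaluation at `x` on `V`, and such a representative is unique. -/
theorem reproducing_kernel_smul (hpos : ∀ f, f ≠ 0 → 0 < B f f)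
    (hinv : ∀ (g : G) f h, B (smulTranslate g f) (smulTranslate g h) = B f h)
    {V : Submodule ℝ C(X, ℝ)} (hV : ∀ (g : G), ∀ f ∈ V, smulTranslate g f ∈ V)
    {k : X → C(X, ℝ)} (hkV : ∀ x, k x ∈ V) (hk : ∀ x, ∀ f ∈ V, B (k x) f = f x)
    (g : G) (x : X) : smulTranslate g (k (g • x)) = k x := by
  refine eq_of_forall_mem_eq hpos (hV g _ (hkV _)) (hkV x) fun f hf => ?_
  rw [hk x f hf, ← smulTranslate_smulTranslate_inv g f, hinv, hk _ _ (hV _ f hf)]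
  simp

/-- If any two points can be swapped by the group, two invariant finite-dimensional spaces of
continuous functions have commuting orthogonal projections; hence if they are distinct, of the
same dimension, the first contains a nonzero function orthogonal to the second. -/
theorem exists_ne_zero_orthogonal (hsymm : ∀ f h, B f h = B h f)
    (hpos : ∀ f, f ≠ 0 → 0 < B f f)
    (hinv : ∀ (g : G) f h, B (smulTranslate g f) (smulTranslate g h) = B f h)
    (hswap : ∀ x y : X, ∃ g : G, g • x = y ∧ g • y = x)
    {V₀ V₁ : Submodule ℝ C(X, ℝ)} [FiniteDimensional ℝ V₀] [FiniteDimensional ℝ V₁]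
    (hV₀ : ∀ (g : G), ∀ f ∈ V₀, smulTranslate g f ∈ V₀)
    (hV₁ : ∀ (g : G), ∀ f ∈ V₁, smulTranslate g f ∈ V₁)
    (hdim : Module.finrank ℝ V₁ = Module.finrank ℝ V₀) (hne : V₁ ≠ V₀) :
    ∃ f ∈ V₀, f ≠ 0 ∧ ∀ h ∈ V₁, B f h = 0 := by
  by_contra! hcon
  -- The negated claim says that the projection to `V₁` is injective on `V₀`.
  have hinj : ∀ f ∈ V₀, ∀ f' ∈ V₀, (∀ h ∈ V₁, B f h = B f' h) → f = f' := by
    intro f hf f' hf' h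
    by_contra hff
    obtain ⟨a, ha, hna⟩ := hcon (f - f') (sub_mem hf hf') (sub_ne_zero.2 hff)
    exact hna (by rw [LinearMap.BilinForm.sub_left, h a ha, sub_self])
  let ev : X → C(X, ℝ) →ₗ[ℝ] ℝ := fun x =>
    { toFun := fun f => f x, map_add' := fun _ _ => rfl, map_smul' := fun _ _ => rfl }
  choose k hkV hk using fun x => exists_mem_forall_eq_of_posDef hpos V₀ (ev x)
  choose l hlV hl using fun x => exists_mem_forall_eq_of_posDef hpos V₁ (ev x)
  have hkl : ∀ x y, B (k x) (l y) = B (k y) (l x) := by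
    intro x y
    obtain ⟨g, rfl, hg⟩ := hswap x y
    rw [← reproducing_kernel_smul hpos hinv hV₀ hkV hk g x,
      ← reproducing_kernel_smul hpos hinv hV₁ hlV hl g (g • x), hinv, hg]
  have hkV₁ : ∀ x, k x ∈ V₁ := by
    intro x
    obtain ⟨q, hq, hqB⟩ := exists_mem_forall_eq_of_posDef hpos V₁ (B (k x))
    obtain ⟨p, hp, hpB⟩ := exists_mem_forall_eq_of_posDef hpos V₀ (B (l x))
    -- `q` is the projection of `k x` to `V₁`, `p` that of `l x` to `V₀`; their values at `y` are
    -- the two sides of `hkl`. So `q` lies in both spaces, and injectivity gives `q = k x`.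
    have hqp : q = p := by
      ext y
      have h₁ : B (l y) q = q y := hl y q hq
      have h₂ : B (k y) p = p y := hk y p hp
      rw [← h₁, ← h₂, hsymm, hqB _ (hlV y), hsymm _ p, hpB _ (hkV y), hkl, hsymm]
    rw [← hinj q (hqp ▸ hp) (k x) (hkV x) hqB]
    exact hq
  -- All the kernels `k x` lie in `V₀ ⊓ V₁`, so `f` and its projection there agree at every point.
  have hle : V₀ ≤ V₁ := by
    intro f hf
    obtain ⟨r, hr, hrB⟩ := exists_mem_forall_eq_of_posDef hpos (V₀ ⊓ V₁) (B f)
    have : f = r := by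
      ext x
      have h := hrB (k x) ⟨hkV x, hkV₁ x⟩
      rw [hsymm, hsymm f] at h
      exact ((hk x f hf).symm.trans h.symm).trans (hk x r hr.1)
    exact this ▸ hr.2
  exact hne (Submodule.eq_of_le_of_finrank_eq hle hdim.symm).symm

end InvariantSubspaces

/-! ### The invariant inner product from Haar measure. -/

section InvariantForm

open MeasureTheory

/-- On a homogeneous space of a compact group there is an invariant inner product on the
continuous functions which is dominated by the uniform norm. -/
theorem exists_invariant_form {G X : Type*} [Group G] [TopologicalSpace G] [IsTopologicalGroup G]
    [CompactSpace G] [TopologicalSpace X] [MulAction G X] [ContinuousSMul G X]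
    [MulAction.IsPretransitive G X] [Nonempty X] :
    ∃ B : LinearMap.BilinForm ℝ C(X, ℝ), (∀ f h, B f h = B h f) ∧ (∀ f, f ≠ 0 → 0 < B f f) ∧
      (∀ (g : G) f h, B (smulTranslate g f) (smulTranslate g h) = B f h) ∧
      ∀ (f h : C(X, ℝ)) (a b : ℝ), (∀ x, |f x| ≤ a) → (∀ x, |h x| ≤ b) → B f h ≤ a * b := by
  let _ : MeasurableSpace G := borel G
  have : BorelSpace G := ⟨rfl⟩
  let μ : Measure G := Measure.haarMeasure ⊤
  have : IsProbabilityMeasure μ :=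
    ⟨Measure.haarMeasure_self (K₀ := (⊤ : TopologicalSpace.PositiveCompacts G))⟩
  obtain ⟨x₀⟩ := ‹Nonempty X›
  have hc : ∀ f : C(X, ℝ), Continuous fun g : G => f (g • x₀) := fun f => by fun_prop
  have hi : ∀ f h : C(X, ℝ), Integrable (fun g : G => f (g • x₀) * h (g • x₀)) μ :=
    fun f h => ((hc f).mul (hc h)).integrable_of_compactSpace μ
  let B : LinearMap.BilinForm ℝ C(X, ℝ) := LinearMap.mk₂ ℝ
    (fun f h => ∫ g, f (g • x₀) * h (g • x₀) ∂μ)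
    (fun f f' h => by
      rw [← integral_add (hi f h) (hi f' h)]
      simp only [ContinuousMap.add_apply, add_mul])
    (fun c f h => by
      rw [smul_eq_mul, ← integral_const_mul]
      simp only [ContinuousMap.smul_apply, smul_eq_mul, mul_assoc])
    (fun f h h' => by
      rw [← integral_add (hi f h) (hi f h')]
      simp only [ContinuousMap.add_apply, mul_add])
    (fun c f h => by
      rw [smul_eq_mul, ← integral_const_mul]
      simp only [ContinuousMap.smul_apply, smul_eq_mul, mul_left_comm])
  have hB : ∀ f h, B f h = ∫ g, f (g • x₀) * h (g • x₀) ∂μ := fun _ _ => rfl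
  refine ⟨B, fun f h => ?_, fun f hf => ?_, fun k f h => ?_, fun f h a b ha hb => ?_⟩
  · simp only [hB, mul_comm]
  -- Transitivity is what makes the form definite: the orbit of `x₀` meets a point where `f` is
  -- nonzero.
  · obtain ⟨x, hx⟩ := DFunLike.ne_iff.1 hf
    obtain ⟨g, rfl⟩ := MulAction.exists_smul_eq G x₀ x
    rw [hB]
    exact ((hc f).mul (hc f)).integral_pos_of_hasCompactSupport_nonneg_nonzero
      (HasCompactSupport.of_compactSpace _) (fun g => mul_self_nonneg _)
      (x := g) (mul_self_ne_zero.2 hx)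
  · simp only [hB, smulTranslate_apply, smul_smul]
    exact integral_mul_left_eq_self (fun g => f (g • x₀) * h (g • x₀)) k
  · calc B f h ≤ ∫ _, a * b ∂μ := integral_mono (hi f h) (integrable_const _) fun g => ?_
      _ = a * b := by simp
    have h₁ := ha (g • x₀)
    calc f (g • x₀) * h (g • x₀) ≤ |f (g • x₀) * h (g • x₀)| := le_abs_self _
      _ = |f (g • x₀)| * |h (g • x₀)| := abs_mul _ _
      _ ≤ a * b := mul_le_mul h₁ (hb _) (abs_nonneg _) ((abs_nonneg _).trans h₁)

end InvariantForm

/-! ### Spans of probabilistic structures and their distance. -/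

section Unrestricted

variable {G X : Type*} [Group G] [MulAction G X] {F : Set (X → ℝ)}

theorem comp_smul_mem_opfSpan (hF : IsProbabilisticStructure G F) (g : G) {f : X → ℝ}
    (hf : f ∈ opfSpan F) : (fun x => f (g • x)) ∈ opfSpan F := by
  have hle : opfSpan F ≤ (opfSpan F).comap (LinearMap.funLeft ℝ ℝ fun x : X => g • x) :=
    Submodule.span_le.2 fun f hf => Submodule.subset_span (hF.comp_smul f hf g)
  exact hle hf

theorem one_mem_opfSpan (hF : IsProbabilisticStructure G F) : (1 : X → ℝ) ∈ opfSpan F := by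
  obtain ⟨f, hf⟩ := hF.nonempty
  have h : (1 : X → ℝ) = f + fun x => 1 - f x := funext fun x => (add_sub_cancel (f x) 1).symm
  rw [h]
  exact add_mem (Submodule.subset_span hf) (Submodule.subset_span (hF.complement f hf))

/-- Values in `[0,1]` supply the bounds without which real suprema and infima would take default
values. -/
theorem le_structureDist [Nonempty X] {F₀ F₁ : Set (X → ℝ)} (h₀ : IsProbabilisticStructure G F₀)
    (h₁ : IsProbabilisticStructure G F₁) {ε : ℝ} {f₀ : X → ℝ} (hf₀ : f₀ ∈ F₀)
    (h : ∀ f₁ ∈ F₁, ∀ b, (∀ x, |f₀ x - f₁ x| ≤ b) → ε ≤ b) : ε ≤ structureDist F₀ F₁ := by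
  have hle : ∀ f ∈ F₀, ∀ f' ∈ F₁, ∀ x, |f x - f' x| ≤ 1 := fun f hf f' hf' x => by
    have a := h₀.mem_unitInterval f hf x
    have b := h₁.mem_unitInterval f' hf' x
    rw [abs_le]
    constructor <;> linarith [a.1, a.2, b.1, b.2]
  have : Nonempty F₁ := h₁.nonempty.to_subtype
  have hbdd : BddAbove (Set.range fun f₀ : F₀ => ⨅ f₁ : F₁, opfDist (f₀ : X → ℝ) (f₁ : X → ℝ)) := by
    refine ⟨1, ?_⟩
    rintro _ ⟨f, rfl⟩
    obtain ⟨f', hf'⟩ := h₁.nonempty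
    refine (ciInf_le ⟨0, ?_⟩ (⟨f', hf'⟩ : F₁)).trans (ciSup_le (hle f f.2 f' hf'))
    rintro _ ⟨f₁, rfl⟩
    exact Real.iSup_nonneg fun x => abs_nonneg _
  refine le_trans ?_ (le_ciSup hbdd ⟨f₀, hf₀⟩)
  refine le_ciInf fun f₁ => h f₁ f₁.2 _ fun x => ?_
  refine le_ciSup (f := fun x => |f₀ x - (f₁ : X → ℝ) x|) ⟨1, ?_⟩ x
  rintro _ ⟨y, rfl⟩
  exact hle f₀ hf₀ f₁ f₁.2 y

variable [TopologicalSpace X]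

/-- The space `ℝ[F]` as a space of continuous functions. -/
def continuousOpfSpan (F : Set (X → ℝ)) : Submodule ℝ C(X, ℝ) :=
  (opfSpan F).comap (ContinuousMap.coeFnLinearMap ℝ)

theorem map_continuousOpfSpan (hF : ∀ f ∈ F, Continuous f) :
    (continuousOpfSpan F).map (ContinuousMap.coeFnLinearMap ℝ) = opfSpan F := by
  refine Submodule.map_comap_eq_of_le (Submodule.span_le.2 fun f hf => ?_)
  exact ⟨⟨f, hF f hf⟩, rfl⟩

theorem nonempty_equiv_continuousOpfSpan (hF : ∀ f ∈ F, Continuous f) :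
    Nonempty (continuousOpfSpan F ≃ₗ[ℝ] opfSpan F) :=
  ⟨(Submodule.equivMapOfInjective _ (fun _ _ h => DFunLike.coe_injective h) _).trans
    (LinearEquiv.ofEq _ _ (map_continuousOpfSpan hF))⟩

theorem IsUnrestrictedStructure.eq_of_opfSpan_eq {F' : Set (X → ℝ)}
    (hF : IsUnrestrictedStructure G F) (hF' : IsUnrestrictedStructure G F')
    (h : opfSpan F = opfSpan F') : F = F' := by
  ext f
  exact ⟨fun hf => hF'.unrestricted f (h ▸ Submodule.subset_span hf) (hF.mem_unitInterval f hf),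
    fun hf => hF.unrestricted f (h ▸ Submodule.subset_span hf) (hF'.mem_unitInterval f hf)⟩

end Unrestricted

/-! ### Rigidity, the Gelfand property and the main theorem. -/

theorem isRigid_of_exists_smul_swap {G X : Type*} [Group G] [TopologicalSpace G]
    [IsTopologicalGroup G] [CompactSpace G] [TopologicalSpace X] [CompactSpace X] [MulAction G X]
    [ContinuousSMul G X] (hswap : ∀ x y : X, ∃ g : G, g • x = y ∧ g • y = x)
    {F₀ : Set (X → ℝ)} (h₀ : IsUnrestrictedStructure G F₀) : IsRigid G F₀ := by
  rcases isEmpty_or_nonempty X with hX | hX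
  -- On empty `X` there is only one function, so all nonempty structures coincide.
  · refine ⟨1, one_pos, fun F₁ h₁ _ hne => (hne ?_).elim⟩
    exact h₁.nonempty.eq_univ.trans h₀.nonempty.eq_univ.symm
  have : MulAction.IsPretransitive G X := ⟨fun x y => (hswap x y).imp fun _ h => h.1⟩
  obtain ⟨B, hsymm, hpos, hinv, hbound⟩ := exists_invariant_form (G := G) (X := X)
  set V := continuousOpfSpan (X := X) with hV
  have hfin : ∀ {F : Set (X → ℝ)}, IsUnrestrictedStructure G F → FiniteDimensional ℝ (V F) :=
    fun {F} hF => by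
      obtain ⟨e⟩ := nonempty_equiv_continuousOpfSpan hF.continuous
      have := hF.finiteDimensional
      exact e.symm.finiteDimensional
  have htr : ∀ {F : Set (X → ℝ)}, IsUnrestrictedStructure G F → ∀ (g : G), ∀ f ∈ V F,
      smulTranslate g f ∈ V F :=
    fun {F} hF g f hf => comp_smul_mem_opfSpan hF.toIsProbabilisticStructure g hf
  have hone : ∀ {F : Set (X → ℝ)}, IsUnrestrictedStructure G F → (1 : C(X, ℝ)) ∈ V F :=
    fun {F} hF => one_mem_opfSpan hF.toIsProbabilisticStructure
  have := hfin h₀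
  let ev : X → C(X, ℝ) →ₗ[ℝ] ℝ := fun x =>
    { toFun := fun f => f x, map_add' := fun _ _ => rfl, map_smul' := fun _ _ => rfl }
  choose k hkV hk using fun x => exists_mem_forall_eq_of_posDef hpos (V F₀) (ev x)
  replace hk : ∀ x, ∀ f ∈ V F₀, B (k x) f = f x := hk
  obtain ⟨x₀⟩ := id hX
  have hκ : ∀ x, B (k x) (k x) = B (k x₀) (k x₀) := by
    intro x
    obtain ⟨g, rfl⟩ := MulAction.exists_smul_eq G x₀ x
    rw [← reproducing_kernel_smul hpos hinv (htr h₀) hkV hk g x₀, hinv]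
  have hκ_pos : 0 < B (k x₀) (k x₀) := by
    refine hpos _ fun h => ?_
    have := hk x₀ 1 (hone h₀)
    rw [h] at this
    simp at this
  set κ := B (k x₀) (k x₀)
  -- `κ`, the constant diagonal value of the kernel, depends only on `F₀` and the form.
  -- Cauchy–Schwarz with `k z` gives `M ^ 2 ≤ κ * B f f`.
  refine ⟨1 / (2 * κ), by positivity, fun F₁ h₁ hdim hne => ?_⟩
  have := hfin h₁
  obtain ⟨e₀⟩ := nonempty_equiv_continuousOpfSpan h₀.continuous
  obtain ⟨e₁⟩ := nonempty_equiv_continuousOpfSpan h₁.continuous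
  have hVne : V F₁ ≠ V F₀ := fun h => hne <| h₁.eq_of_opfSpan_eq h₀ <| by
    rw [← map_continuousOpfSpan h₁.continuous, ← map_continuousOpfSpan h₀.continuous]
    exact congrArg _ h
  obtain ⟨f, hf, hf0, hfV⟩ := exists_ne_zero_orthogonal hsymm hpos hinv hswap (htr h₀) (htr h₁)
    (e₁.finrank_eq.trans (hdim.trans e₀.finrank_eq.symm)) hVne
  obtain ⟨z, -, hz⟩ := isCompact_univ.exists_isMaxOn Set.univ_nonempty
    (f := fun x => |f x|) (by fun_prop)
  replace hz : ∀ x, |f x| ≤ |f z| := fun x => hz (Set.mem_univ x)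
  have hM : 0 < |f z| := by
    obtain ⟨y, hy⟩ := DFunLike.ne_iff.1 hf0
    exact (abs_pos.2 hy).trans_le (hz y)
  set M := |f z|
  have hff : M ^ 2 ≤ κ * B f f := by
    have := B.apply_sq_le_of_symm (fun x => by
      rcases eq_or_ne x 0 with rfl | hx
      · simp
      · exact (hpos x hx).le) ⟨fun a b => hsymm a b⟩ (k z) f
    rwa [hk z f hf, hκ z, ← sq_abs] at this
  let f₀ : C(X, ℝ) := (1 / 2 : ℝ) • (1 + M⁻¹ • f)
  have hf₀ : (f₀ : X → ℝ) ∈ F₀ := by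
    refine h₀.unrestricted _ (Submodule.smul_mem (V F₀) _
      (add_mem (hone h₀) (Submodule.smul_mem _ _ hf))) fun x => ?_
    have hx : |M⁻¹ * f x| ≤ 1 := by
      rw [abs_mul, abs_of_pos (inv_pos.2 hM), inv_mul_le_iff₀ hM, mul_one]
      exact hz x
    have := abs_le.1 hx
    have hv : f₀ x = 1 / 2 * (1 + M⁻¹ * f x) := rfl
    rw [hv]
    constructor <;> linarith [this.1, this.2]
  refine le_max_of_le_left (le_structureDist h₀.toIsProbabilisticStructure
    h₁.toIsProbabilisticStructure hf₀ fun f₁ hf₁ b hb => ?_)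
  let f₁' : C(X, ℝ) := ⟨f₁, h₁.continuous f₁ hf₁⟩
  have hf₁' : f₁' ∈ V F₁ := (Submodule.subset_span hf₁ : f₁ ∈ opfSpan F₁)
  -- Pairing with `f` kills `1` and `f₁'`, leaving `B f f / (2 * M) ≤ M * b`; hence `b ≥ 1 / (2 *
  -- κ)`.
  have hle : B f (f₀ - f₁') ≤ M * b := hbound f _ M b hz hb
  have heq : B f (f₀ - f₁') = (1 / 2) * (M⁻¹ * B f f) := by
    simp only [f₀, map_sub, map_smul, map_add, smul_eq_mul, hfV _ hf₁', hfV _ (hone h₁)]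
    ring
  rw [heq] at hle
  rw [div_le_iff₀ (by positivity)]
  have h₂ : B f f ≤ 2 * M ^ 2 * b := by
    have := mul_le_mul_of_nonneg_left hle (mul_pos two_pos hM).le
    field_simp at this
    nlinarith
  have h₃ : M ^ 2 * 1 ≤ M ^ 2 * (b * (2 * κ)) := by nlinarith
  exact le_of_mul_le_mul_left h₃ (by positivity)

theorem isGelfandPair_stabilizer_of_exists_smul_swap {G : Type u} {X : Type w} [Group G]
    [MulAction G X] [TopologicalSpace G] [IsTopologicalGroup G] [CompactSpace G]
    [TopologicalSpace X] [T2Space X] [ContinuousSMul G X]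
    (hswap : ∀ x y : X, ∃ g : G, g • x = y ∧ g • y = x) (x : X) :
    IsGelfandPair.{v} G (MulAction.stabilizer G x) := by
  have hclosed : IsClosed (MulAction.stabilizer G x : Set G) :=
    isClosed_singleton.preimage (f := fun g : G => g • x) (by fun_prop)
  have : CompactSpace (MulAction.stabilizer G x) := isCompact_iff_compactSpace.1 hclosed.isCompact
  refine isGelfandPair_of_inv_mem_doubleCoset _ fun g => ?_
  obtain ⟨k, hk, hk'⟩ := hswap x (g • x)
  refine ⟨g⁻¹ * k, ?_, (k * g)⁻¹, ?_, ?_⟩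
  · rw [MulAction.mem_stabilizer_iff, mul_smul, hk, inv_smul_smul]
  · rw [inv_mem_iff, MulAction.mem_stabilizer_iff, mul_smul, hk']
  · group

theorem mainTheorem6 {G : Type u} {X : Type w} [Group G] [MulAction G X] :
    -- the pure-state distance is a bounded, invariant metric
    (∀ F : Set (X → ℝ), IsProbabilisticStructure G F → SeparatesPureStates F →
      (∀ x x', IsLUB {r : ℝ | ∃ f ∈ F, r = f x - f x'} (pureStateDist F x x') ∧
        pureStateDist F x x' ≤ 1) ∧
      IsMetric (pureStateDist F) ∧
      ∀ (g : G) (x x' : X), pureStateDist F (g • x) (g • x') = pureStateDist F x x') ∧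
    -- the compact case
    (∀ [TopologicalSpace G] [IsTopologicalGroup G] [CompactSpace G]
      [TopologicalSpace X] [T2Space X] [CompactSpace X] [ContinuousSMul G X],
      -- two-point homogeneity for the pure-state distance
      (∀ F : Set (X → ℝ), IsProbabilisticStructure G F → SeparatesPureStates F →
        IsTwoPointHomogeneous G (pureStateDist F) →
        (∀ x : X, IsGelfandPair.{v} G (MulAction.stabilizer G x)) ∧
        ∀ F₀ : Set (X → ℝ), IsUnrestrictedStructure G F₀ → IsRigid G F₀) ∧
      -- two-point homogeneity for an arbitrary metric on the pure states
      (∀ d : X → X → ℝ, IsMetric d → IsTwoPointHomogeneous G d →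
        (∀ x : X, IsGelfandPair.{v} G (MulAction.stabilizer G x)) ∧
        ∀ F₀ : Set (X → ℝ), IsUnrestrictedStructure G F₀ → IsRigid G F₀)) := by
  refine ⟨fun F hF hs => ⟨fun x x' => ⟨isLUB_pureStateDist hF x x', pureStateDist_le_one hF x x'⟩,
    isMetric_pureStateDist hF hs, pureStateDist_smul_smul hF⟩, ?_⟩
  intro _ _ _ _ _ _ _
  have key : ∀ d : X → X → ℝ, IsMetric d → IsTwoPointHomogeneous G d →
      (∀ x : X, IsGelfandPair.{v} G (MulAction.stabilizer G x)) ∧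
        ∀ F₀ : Set (X → ℝ), IsUnrestrictedStructure G F₀ → IsRigid G F₀ := fun d hd h =>
    ⟨isGelfandPair_stabilizer_of_exists_smul_swap (h.exists_smul_swap hd),
      fun _ => isRigid_of_exists_smul_swap (h.exists_smul_swap hd)⟩
  exact ⟨fun F hF hs => key _ (isMetric_pureStateDist hF hs), key⟩
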